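/- \textbf{Setting.} Let $\varphi$ be the projection of $\mathbb{R}^3$ along $(1,1,1)$ onto a plane. The projections of the vertices and edges of the cubic grid $\mathbb{Z}^3$ are the vertices and edges of the triangular grid; each edge is directed along one of $\varphi(1,0,0),\varphi(0,1,0),\varphi(0,0,1)$, and has a source and a target accordingly. A calisson is the projection of a face of the cubic grid, that is, the union of two triangles sharing an edge, and its colour is the normal direction of the face. A region $R$ is a finite or infinite set of triangles, possibly slit along some edges; an edge of $R$ (a side of a triangle of $R$) is an inner edge if both triangles at it are in $R$ and $R$ is not slit along it, and a boundary edge otherwise. The vertices and edges through which the boundary passes several times are duplicated: the vertices of $R$ are the classes of the corners of the triangles of $R$, two corners being identified when they are at the same place in two triangles sharing an inner edge (and when this follows by transitivity), and each of the two sides of a slit counts as an edge of its own. The region $R$ is assumed to be simply connected: it is non-empty, connected through adjacency of triangles along inner edges, and each loop in it is null-homotopic. Let $X$ be any set of edges of the triangular grid. $\mathtt{Calissons}(X,R)$ asks for a tiling of $R$ by calissons (each triangle of $R$ is covered exactly once, by calissons contained in $R$ and not overlapping the slits) such that (i) no edge of $X$ is overlapped by the interior of a calisson; (ii) the two calissons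 on both sides of an edge of $X$ that is an inner edge of $R$ have different colours. Let $C=[0,1]^3$, and let $\overline{\square}^3_R$ be the set of the cubes $(x,y,z)+C$, $(x,y,z)\in\mathbb{Z}^3$, such that $\varphi(x,y,z)$ is a vertex of $R$ (one infinite stack of cubes for each vertex of $R$, duplicated vertices having different stacks). The height of $(x,y,z)+C$ is $x+y+z$. Consider the following sets of directed edges on $\overline{\square}^3_R$: \begin{itemize} \item $\wedge_R$: for each edge of $R$ with source $p$ and target $q$ in the direction of $\varphi(u)$, where $u$ is a unit vector of $\mathbb{Z}^3$, the edges from $c+C$ above $p$ to $c+u+C$ above $q$; \item $\vee_R$: the reversed edges of those of $\wedge_R$ above the boundary edges of $R$; \item $\vee_X$: the reversed edges of those of $\wedge_R$ above the edges of $R$ that are in $X$; \item $\lessgtr_X$: for each inner edge $e\in X$ of $R$, in the direction of $\varphi(u)$, and each $c\in\mathbb{Z}^3$ such that $\varphi(c)$ is the source of $e$, the edges in both ways between $c-v+C$ and $c-w+C$, where $v,w$ are the two unit vectors other than $u$; these two cubes lie above the vertices opposite to $e$ in the two triangles on both sides of $e$. \end{itemize} Then $\mathcal{H}_R=(\overline{\square}^3_R,\wedge_R)$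 is a DAG. A DAG cut is a partition of its vertices into two non-empty parts, the lower of which is closed downwards for the transitive closure of the DAG; it cuts an edge if the two ends of this edge are in different parts. In the projection $\varphi(\overline{\square}^3_R,\wedge_R\cup\vee_R\cup\vee_X\cup\lessgtr_X)$, a directed graph on the vertices of $R$, each edge has as weight the height of its destination cube minus that of its source cube ($+1$ for $\wedge_R$, $-1$ for $\vee_R\cup\vee_X$, $0$ for $\lessgtr_X$). An absorbing cycle is a closed walk of negative total weight. \textbf{Theorem.} For a finite or infinite, simply connected region $R$ and a set $X$ of edges, the following are equivalent: \begin{enumerate} \item $\mathtt{Calissons}(X,R)$ has a solution. \item The DAG $\mathcal{H}_R$ has a DAG cut which cuts no edge of $\vee_R\cup\vee_X\cup\lessgtr_X$. \item The graph $(\overline{\square}^3_R,\wedge_R\cup\vee_R\cup\vee_X\cup\lessgtr_X)$ has no path from a cube $(x,y,z)+C$ to a cube $(x-k,y-k,z-k)+C$ of the same stack with $k>0$. \item The weighted projected graph $\varphi(\overline{\square}^3_R,\wedge_R\cup\vee_R\cup\vee_X\cup\lessgtr_X)$ has no absorbing cycle. \end{enumerate} Moreover (Thurston's criterion, the case $X=\emptyset$),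 $R$ can be tiled by calissons if and only if there are heights $h$ on the vertices of the boundary of $R$, increasing by $1$ from the source to the target of each boundary edge, such that $h(v)-h(u)\le d(u,v)$ for all vertices $u,v$ of the boundary, where $d(u,v)$ is the least number of edges of a path from $u$ to $v$ that follows edges of $R$ from their source to their target. -/

import Mathlib

namespace Calissons

/-! ### The cubic grid and the triangular grid -/

/-- The cube `(x, y, z) + [0,1]³` of the cubic grid, given by `(x, y, z) ∈ ℤ³`. -/
abbrev Cube : Type := Fin 3 → ℤ

/-- The height `x + y + z` of a cube. -/
def Cube.height (c : Cube) : ℤ := c 0 + c 1 + c 2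

/-- The vertices of the triangular grid, which is the projection of the cubic grid along
`(1, 1, 1)`. A vertex is given by its coordinates in the basis formed by the projections of
`(1, 0, 0)` and `(0, 1, 0)`; the projection of `(0, 0, 1)` is then `(-1, -1)`. -/
abbrev GridVertex : Type := ℤ × ℤ

/-- The projection along `(1, 1, 1)`. -/
def proj (c : Cube) : GridVertex := (c 0 - c 2, c 1 - c 2)

/-- The three unit directions of the triangular grid: the projections of the unit vectors. -/
def dir (i : Fin 3) : GridVertex := proj (Pi.single i 1)

/-- An edge of the triangular grid: it joins `src` to `src + dir i`. -/
@[ext] structure Edge where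
  src : GridVertex
  i : Fin 3

/-- A triangle of the triangular grid. The triangle `⟨p, true⟩` has the vertices
`p`, `p + dir 0`, `p + dir 0 + dir 1`, and the triangle `⟨p, false⟩` has the vertices
`p`, `p + dir 1`, `p + dir 0 + dir 1`. Both have a side in direction `dir 2`, and they lie on
different sides of it. -/
@[ext] structure Triangle where
  base : GridVertex
  pos : Bool

namespace Triangle

/-- The three corners of a triangle. They are numbered so that the side of the triangle in
direction `dir i` starts at the corner number `i`. -/
def corner (t : Triangle) (i : Fin 3) : GridVertex :=
  match t.pos with
  | true => ![t.base, t.base + dir 0, t.base + dir 0 + dir 1] i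
  | false => ![t.base + dir 1, t.base, t.base + dir 0 + dir 1] i

/-- The side of the triangle in direction `dir i` goes from the corner `i` to the corner
`t.next i`. -/
def next (t : Triangle) (i : Fin 3) : Fin 3 :=
  match t.pos with
  | true => i + 1
  | false => i - 1

/-- The side of a triangle in direction `dir i`. -/
def side (t : Triangle) (i : Fin 3) : Edge := ⟨t.corner i, i⟩

/-- The corner that is opposite to the side in direction `dir i`. -/
def opp (t : Triangle) (i : Fin 3) : Fin 3 := t.next (t.next i)

theorem corner_next (t : Triangle) (i : Fin 3) : t.corner (t.next i) = t.corner i + dir i := by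
  obtain ⟨⟨x, y⟩, b⟩ := t
  cases b <;> fin_cases i <;> simp [corner, next, dir, proj]

end Triangle

/-- A calisson: the projection of a face of the cubic grid. The calisson `⟨p, i⟩` is the
projection of a face with normal direction the `i`-th unit vector, whose lowest vertex projects
to `p`. -/
@[ext] structure Calisson where
  base : GridVertex
  normal : Fin 3

namespace Calisson

/-- The colour of a calisson is the normal direction of the face. -/
def color (c : Calisson) : Fin 3 := c.normal

/-- The edge of the grid that is overlapped by the interior of the calisson: its short diagonal.
It joins the projection of the lowest vertex of the face to the projection of the highest one,
which is `base - dir normal`. -/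
def diag (c : Calisson) : Edge := ⟨c.base - dir c.normal, c.normal⟩

/-- A calisson is the union of the two triangles that have its short diagonal as a side. -/
def Covers (c : Calisson) (t : Triangle) : Prop := t.side c.normal = c.diag

end Calisson

/-! ### Regions -/

/-- A region, finite or not, of the triangular grid: a set of triangles, with a set of edges
along which the region is slit. The boundary of a region passes twice through an edge
along which it is slit, although both triangles at this edge belong to the region. -/
structure Region where
  tri : Set Triangle
  slit : Set Edge

namespace Region

/-- Two triangles of the region are on the two sides of the edge `e`, and the region is not slit
along `e`: the edge `e` is an inner edge of the region. -/
def Joined (R : Region) (e : Edge) (s t : Triangle) : Prop :=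
  s ∈ R.tri ∧ t ∈ R.tri ∧ s ≠ t ∧ s.side e.i = e ∧ t.side e.i = e ∧ e ∉ R.slit

/-- The adjacency graph of the triangles of the region. -/
def dual (R : Region) : SimpleGraph {t : Triangle // t ∈ R.tri} where
  Adj s t := ∃ e, R.Joined e s t
  symm := ⟨fun _ _ ⟨e, h1, h2, h3, h4, h5, h6⟩ => ⟨e, h2, h1, h3.symm, h5, h4, h6⟩⟩
  loopless := ⟨fun _ ⟨_, _, _, h, _⟩ => h rfl⟩

/-- Homotopy of paths of triangles in the region. A loop of triangles that all contain a same
vertex of the grid may be inserted or removed: this covers going back and forth through an edge,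
and turning around a vertex that is surrounded by six triangles of the region joined together.
(In the terms of topology: the edge-path homotopy of the cell decomposition dual to the
triangulation of the region.) -/
inductive Homotopic (R : Region) :
    ∀ {s t : {t : Triangle // t ∈ R.tri}}, R.dual.Walk s t → R.dual.Walk s t → Prop
  | refl {s t} (p : R.dual.Walk s t) : Homotopic R p p
  | symm {s t} {p q : R.dual.Walk s t} : Homotopic R p q → Homotopic R q p
  | trans {s t} {p q r : R.dual.Walk s t} : Homotopic R p q → Homotopic R q r → Homotopic R p r
  | star {s t u} (p : R.dual.Walk s t) (q : R.dual.Walk t u) (c : R.dual.Walk t t)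
      (w : GridVertex) (hc : ∀ x ∈ c.support, ∃ j, x.1.corner j = w) :
      Homotopic R (p.append (c.append q)) (p.append q)

/-- The region is simply connected: it is connected (hence non-empty) through adjacency of
triangles, and every loop is null-homotopic. -/
structure SimplyConnected (R : Region) : Prop where
  connected : R.dual.Connected
  null_homotopic : ∀ t (c : R.dual.Walk t t), R.Homotopic c SimpleGraph.Walk.nil

/-- The corners of the triangles of the region. -/
abbrev Corner (R : Region) : Type := {t : Triangle // t ∈ R.tri} × Fin 3

/-- Two corners at the same place are glued when their triangles are joined along an edge. -/
def Glue (R : Region) (a b : R.Corner) : Prop :=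
  R.dual.Adj a.1 b.1 ∧ a.1.1.corner a.2 = b.1.1.corner b.2

/-- The vertices of the region. A vertex of the grid through which the boundary passes several
times is duplicated: the vertices are the classes of the corners for the equivalence relation
generated by the gluing along inner edges. -/
def Vertex (R : Region) : Type := Quot R.Glue

/-- The place in the grid of a vertex of the region. -/
def Vertex.place {R : Region} : R.Vertex → GridVertex :=
  Quot.lift (fun a => a.1.1.corner a.2) fun _ _ h => h.2

/-- The vertex of the region at a corner of a triangle of the region. -/
def vertex (R : Region) (t : {t : Triangle // t ∈ R.tri}) (j : Fin 3) : R.Vertex :=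
  Quot.mk _ (t, j)

/-- The side of `t` in direction `dir i` is an edge of the boundary of the region: no triangle of
the region is joined to `t` along it. -/
def IsBoundarySide (R : Region) (t : {t : Triangle // t ∈ R.tri}) (i : Fin 3) : Prop :=
  ∀ s, ¬ R.Joined (t.1.side i) t s

/-! ### Tilings and the puzzle -/

/-- A set of calissons tiles the region: every calisson of the set lies in the region (and does
not overlap an edge along which the region is slit), and every triangle of the region is covered
exactly once. -/
structure IsTiling (R : Region) (T : Set Calisson) : Prop where
  inside : ∀ c ∈ T, c.diag ∉ R.slit ∧ ∀ t, c.Covers t → t ∈ R.tri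
  partition : ∀ t ∈ R.tri, ∃! c, c ∈ T ∧ c.Covers t

/-- A solution of the puzzle given by a region and a set `X` of edges: a tiling in which
no edge of `X` is overlapped by a calisson, and the two calissons on both sides of an edge of `X`
(not on the boundary of the region) have different colours. -/
structure IsSolution (R : Region) (X : Set Edge) (T : Set Calisson) : Prop where
  tiling : R.IsTiling T
  non_overlap : ∀ e ∈ X, ∀ c ∈ T, c.diag ≠ e
  saliency : ∀ e ∈ X, ∀ s t, R.Joined e s t →
    ∀ c ∈ T, ∀ d ∈ T, c.Covers s → d.Covers t → c.color ≠ d.color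

/-! ### The graph of cubes above the region -/

/-- The cubes above the region: a stack of cubes, infinite in both directions, above every
vertex of the region. -/
@[ext] structure StackCube (R : Region) where
  stack : R.Vertex
  cube : Cube
  proj_cube : proj cube = stack.place

variable (R : Region) (X : Set Edge)

/-- The ascending edges, from `c` to `c + (1, 0, 0)`, `c + (0, 1, 0)` or `c + (0, 0, 1)`, above
the edges of the region. -/
def Up (a b : R.StackCube) : Prop :=
  ∃ t i, a.stack = R.vertex t i ∧ b.stack = R.vertex t (t.1.next i) ∧
    b.cube = a.cube + Pi.single i 1

/-- The descending unbreakable edges given by the boundary of the region. -/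
def DownBoundary (a b : R.StackCube) : Prop :=
  ∃ t i, R.IsBoundarySide t i ∧ a.stack = R.vertex t (t.1.next i) ∧ b.stack = R.vertex t i ∧
    a.cube = b.cube + Pi.single i 1

/-- The descending unbreakable edges given by the non-overlap condition of the edges of `X`. -/
def DownX (a b : R.StackCube) : Prop :=
  ∃ t i, t.1.side i ∈ X ∧ a.stack = R.vertex t (t.1.next i) ∧ b.stack = R.vertex t i ∧
    a.cube = b.cube + Pi.single i 1

/-- The unbreakable edges of height difference `0` (in both ways, as `s` and `t` play symmetric
roles) given by the saliency condition of the inner edges `e` of the region in `X`. If `c` is a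
cube that projects to the source of `e`, they join `c` minus the `j`-th unit vector and `c` minus
the `k`-th one, where `j` and `k` are the two directions other than that of `e`; these two cubes
project to the two corners opposite to `e` in the triangles on both sides of `e`. -/
def Flat (a b : R.StackCube) : Prop :=
  ∃ s t : {t : Triangle // t ∈ R.tri}, ∃ e ∈ X, R.Joined e s t ∧
    a.stack = R.vertex s (s.1.opp e.i) ∧ b.stack = R.vertex t (t.1.opp e.i) ∧
    ∃ c : Cube, proj c = e.src ∧
      a.cube = c - Pi.single (s.1.opp e.i) 1 ∧ b.cube = c - Pi.single (t.1.opp e.i) 1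

/-- The unbreakable edges that have been added to the ascending ones. -/
def Unbreakable (a b : R.StackCube) : Prop :=
  R.DownBoundary a b ∨ R.DownX X a b ∨ R.Flat X a b

/-- The graph of cubes with all its edges. -/
def Arc (a b : R.StackCube) : Prop := R.Up a b ∨ R.Unbreakable X a b

/-- `L` is the lower part of a cut of the directed acyclic graph of the ascending edges: `L` and
its complement are not empty, and `L` is a lower set for the transitive closure. -/
structure IsDAGCut (L : Set R.StackCube) : Prop where
  nonempty : L.Nonempty
  nonempty_compl : Lᶜ.Nonempty
  lower : ∀ a ∈ L, ∀ b, Relation.ReflTransGen R.Up b a → b ∈ L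

/-- The partition in `L` and its complement cuts the edge from `a` to `b`. -/
def Cuts (L : Set R.StackCube) (a b : R.StackCube) : Prop :=
  (a ∈ L ∧ b ∉ L) ∨ (a ∉ L ∧ b ∈ L)

/-- There is a path from a cube to a strictly lower cube of the same stack. -/
def HasDescendingPath : Prop :=
  ∃ (a b : R.StackCube) (k : ℤ), 0 < k ∧ Relation.ReflTransGen (R.Arc X) a b ∧
    b.stack = a.stack ∧ ∀ j, b.cube j = a.cube j - k

/-! ### The weighted projected graph -/

/-- The projected graph has an edge of weight `w` from `u` to `v`: it is the projection of an edge
of the graph of cubes, and its weight is the difference of height. -/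
def ProjArc (u v : R.Vertex) (w : ℤ) : Prop :=
  ∃ a b : R.StackCube, R.Arc X a b ∧ a.stack = u ∧ b.stack = v ∧
    w = b.cube.height - a.cube.height

/-- The projected graph has a path from `u` to `v` of total weight `w`. -/
inductive ProjPath : R.Vertex → R.Vertex → ℤ → Prop
  | nil (u) : ProjPath u u 0
  | cons {u v x w m} : R.ProjArc X u v w → ProjPath v x m → ProjPath u x (w + m)

/-- The projected graph has an absorbing cycle: a closed path of negative weight. -/
def HasAbsorbingCycle : Prop := ∃ (u : R.Vertex) (w : ℤ), R.ProjPath X u u w ∧ w < 0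

/-! ### The criterion on the boundary -/

/-- The vertices of the boundary. -/
def IsBoundaryVertex (u : R.Vertex) : Prop :=
  ∃ t i, R.IsBoundarySide t i ∧ (u = R.vertex t i ∨ u = R.vertex t (t.1.next i))

/-- There is a path of `n` edges of the region from `u` to `v`, each of them followed in one of
the directions `dir 0`, `dir 1`, `dir 2`. -/
inductive DirPath : R.Vertex → R.Vertex → ℕ → Prop
  | nil (u) : DirPath u u 0
  | cons (t i) {v n} : DirPath (R.vertex t (t.1.next i)) v n → DirPath (R.vertex t i) v (n + 1)

/-- The directed distance from `u` to `v` in the region. -/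
noncomputable def dirDist (u v : R.Vertex) : ℕ := sInf {n | R.DirPath u v n}

/-- Thurston's criterion: following the edges of the boundary, and adding `1` for a step
in the directions `dir 0`, `dir 1`, `dir 2`, gives consistent heights `h` to the vertices of the
boundary, and `h v - h u` is at most the directed distance from `u` to `v`. -/
def ThurstonCriterion : Prop :=
  ∃ h : R.Vertex → ℤ,
    (∀ t i, R.IsBoundarySide t i → h (R.vertex t (t.1.next i)) = h (R.vertex t i) + 1) ∧
    ∀ u v, R.IsBoundaryVertex u → R.IsBoundaryVertex v → h v - h u ≤ R.dirDist u v

end Region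

end Calissons

/-!
# Calisson puzzles and DAG cuts

Everything is read off an integer height `h` on the vertices of the region. A *potential* is a
height that increases by at most the weight of each arc of the weighted projected graph
(`Region.IsPotential`); the four conditions are all equivalent to the existence of a potential.

* The corners of a triangle covered by a calisson have heights increasing by `1`, `1` and `-2` when
  one turns around the triangle, the drop being along the diagonal of the calisson. These local
  heights agree up to a constant on the common side of adjacent triangles, and they glue to a height
  on the vertices because the region is simply connected
  (`Region.SimplyConnected.exists_height`): the offsets between adjacent triangles telescope around
  each grid vertex, so that their sum along a walk is invariant by homotopy. Boundary edges and
  edges of `X` are never diagonals, and the two colours at an inner edge of `X` differ exactly when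
  the two vertices opposite to it have equal heights (`Region.Joined.height_opp_eq_iff`); hence the
  height is a potential.
* Conversely, weights are congruent modulo `3` to the differences of `level`, so that a potential
  can be rounded down to one with `h v` congruent to `level v.place` modulo `3`. It then increases
  by `1` along two sides of each triangle and drops by `2` along the third one
  (`Region.IsPotential.exists_drop`), and the calissons on the drops tile the region.
* The cubes of height at most `h` form the lower part of a cut (`Region.IsPotential.exists_dagCut`).
  No arc enters the lower part of such a cut from outside, whereas a descending path, once repeated,
  would give a path from each cube to each other one (`Region.IsDAGCut.not_hasDescendingPath`). An
  absorbing cycle lifts to a descending path, and without absorbing cycle the shortest path weights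
  from a vertex are a potential.

For the criterion on the boundary, the least of the `h u + d(u, v)` over the boundary vertices `u`
is a potential that extends `h` (`Region.ThurstonCriterion.exists_isPotential`).
-/

namespace Calissons

/-! ### Triangles, edges and cubes -/

/-- The sum of the two coordinates of a grid vertex. It increases by `1` modulo `3` in each of the
three directions, and it is congruent modulo `3` to the height of every cube above the vertex. -/
def level (p : GridVertex) : ℤ := p.1 + p.2

theorem exists_level_add_dir (p : GridVertex) (i : Fin 3) :
    level (p + dir i) = level p + 1 ∨ level (p + dir i) = level p - 2 := by
  fin_cases i <;> simp [level, dir, proj] <;> omega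

namespace Triangle

theorem corner_injective (t : Triangle) : Function.Injective t.corner := by
  obtain ⟨⟨x, y⟩, b⟩ := t
  intro i j
  cases b <;> fin_cases i <;> fin_cases j <;> simp [corner, dir, proj]

theorem next_opp (t : Triangle) (i : Fin 3) : t.next (t.opp i) = i := by
  obtain ⟨p, b⟩ := t
  cases b <;> fin_cases i <;> rfl

/-- A triangle is determined by one of its sides and its orientation. -/
theorem eq_of_side_eq {s t : Triangle} {i : Fin 3} (h : s.side i = t.side i)
    (hp : s.pos = t.pos) : s = t := by
  obtain ⟨⟨x, y⟩, b⟩ := s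
  obtain ⟨⟨x', y'⟩, b'⟩ := t
  obtain rfl : b = b' := hp
  cases b <;> fin_cases i <;> simp [side, corner, dir, proj] at h ⊢ <;> omega

theorem pos_ne_of_side_eq {s t : Triangle} {i : Fin 3} (h : s.side i = t.side i)
    (hst : s ≠ t) : s.pos ≠ t.pos :=
  fun hp => hst (eq_of_side_eq h hp)

/-- Every edge of the grid has a triangle on its other side. -/
theorem exists_side_eq (t : Triangle) (i : Fin 3) : ∃ s, s ≠ t ∧ s.side i = t.side i := by
  obtain ⟨p, b⟩ := t
  refine ⟨⟨p + (Triangle.corner ⟨p, b⟩ i - Triangle.corner ⟨p, !b⟩ i), !b⟩, ?_, ?_⟩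
  · cases b <;> simp
  · cases b <;> fin_cases i <;> simp [side, corner]

/-- The two triangles at an edge share only the two ends of this edge. -/
theorem common_corner {s t : Triangle} {i j k : Fin 3} (h : s.side i = t.side i) (hst : s ≠ t)
    (hjk : s.corner j = t.corner k) : j = i ∧ k = i ∨ j = s.next i ∧ k = t.next i := by
  have hp := pos_ne_of_side_eq h hst
  obtain ⟨⟨x, y⟩, b⟩ := s
  obtain ⟨⟨x', y'⟩, b'⟩ := t
  cases b <;> cases b' <;> simp at hp <;> fin_cases i <;> fin_cases j <;> fin_cases k <;>
    first
    | exact Or.inl ⟨rfl, rfl⟩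
    | exact Or.inr ⟨rfl, rfl⟩
    | exact absurd h (by simp [side, corner, dir, proj] at hjk ⊢; omega)

/-- The two triangles at an edge turn around in opposite senses. -/
theorem opp_eq_next {s t : Triangle} {i : Fin 3} (h : s.side i = t.side i) (hst : s ≠ t) :
    t.opp i = s.next i := by
  have hp := pos_ne_of_side_eq h hst
  obtain ⟨p, b⟩ := s
  obtain ⟨p', b'⟩ := t
  cases b <;> cases b' <;> simp at hp <;> fin_cases i <;> rfl

theorem corner_opp_add_dir (t : Triangle) (i : Fin 3) :
    t.corner (t.opp i) + dir (t.opp i) = t.corner i := by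
  rw [← corner_next, next_opp]

theorem eq_or_eq_next_or_eq_opp (t : Triangle) (i j : Fin 3) :
    j = i ∨ j = t.next i ∨ j = t.opp i := by
  obtain ⟨p, b⟩ := t
  revert i j
  cases b <;> simp only [next, opp] <;> decide

theorem next_ne (t : Triangle) (i : Fin 3) : t.next i ≠ i := by
  obtain ⟨p, b⟩ := t
  revert i
  cases b <;> simp only [next] <;> decide

theorem opp_ne (t : Triangle) (i : Fin 3) : t.opp i ≠ i := by
  obtain ⟨p, b⟩ := t
  revert i
  cases b <;> simp only [next, opp] <;> decide

theorem opp_ne_next (t : Triangle) (i : Fin 3) : t.opp i ≠ t.next i :=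
  t.next_ne _

/-- The calisson that has the side of `t` in direction `dir i` as its short diagonal. -/
def calisson (t : Triangle) (i : Fin 3) : Calisson := ⟨t.corner i + dir i, i⟩

theorem covers_iff (t : Triangle) (c : Calisson) :
    c.Covers t ↔ c = t.calisson c.normal := by
  obtain ⟨p, i⟩ := c
  rw [Calisson.Covers, calisson, side, Calisson.diag, Edge.mk.injEq, Calisson.mk.injEq,
    eq_sub_iff_add_eq, eq_comm]

theorem calisson_covers (t : Triangle) (i : Fin 3) : (t.calisson i).Covers t :=
  (t.covers_iff _).2 rfl

end Triangle

theorem Cube.height_eq (c : Cube) : c.height = level (proj c) + 3 * c 2 := by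
  simp only [Cube.height, level, proj]; ring

theorem Cube.height_add_single (c : Cube) (i : Fin 3) (m : ℤ) :
    Cube.height (c + Pi.single i m) = c.height + m := by
  fin_cases i <;> simp [Cube.height] <;> ring

theorem proj_add_single (c : Cube) (i : Fin 3) : proj (c + Pi.single i 1) = proj c + dir i := by
  fin_cases i <;> ext <;> simp [proj, dir] <;> ring

theorem proj_sub_single (c : Cube) (i : Fin 3) : proj (c - Pi.single i 1) = proj c - dir i := by
  rw [eq_sub_iff_add_eq, ← proj_add_single, sub_add_cancel]

theorem Cube.height_sub_single (c : Cube) (i : Fin 3) (m : ℤ) :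
    Cube.height (c - Pi.single i m) = c.height - m := by
  rw [eq_sub_iff_add_eq, ← Cube.height_add_single _ i, sub_add_cancel]

theorem Cube.ext_height {a b : Cube} (hp : proj a = proj b) (hh : a.height = b.height) :
    a = b := by
  simp only [proj, Prod.mk.injEq, Cube.height] at hp hh
  funext j
  fin_cases j <;> simp <;> omega

/-- The cube above `p` with the height `level p + 3 * m`. -/
theorem exists_cube (p : GridVertex) (m : ℤ) :
    ∃ c : Cube, proj c = p ∧ c.height = level p + 3 * m :=
  ⟨![p.1 + m, p.2 + m, m], by simp [proj], by simp [Cube.height, level]; ring⟩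

namespace Region

/-! ### Gluing local heights in a simply connected region -/

section Gluing

variable {V : Type*} {G : SimpleGraph V}

/-- The sum of the increments `δ` along a walk. -/
def walkSum (δ : V → V → ℤ) : ∀ {u v : V}, G.Walk u v → ℤ
  | _, _, .nil => 0
  | _, _, .cons (u := u) (v := v) _ p => δ u v + walkSum δ p

theorem walkSum_append (δ : V → V → ℤ) {u v w : V} (p : G.Walk u v) (q : G.Walk v w) :
    walkSum δ (p.append q) = walkSum δ p + walkSum δ q := by
  induction p with
  | nil => simp [walkSum]
  | cons _ p ih => simp [walkSum, ih, add_assoc]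

end Gluing

variable {R : Region} {X : Set Edge}

theorem walkSum_eq_of_homotopic (δ : {t // t ∈ R.tri} → {t // t ∈ R.tri} → ℤ)
    (hδ : ∀ t (c : R.dual.Walk t t) (w : GridVertex),
      (∀ x ∈ c.support, ∃ j, x.1.corner j = w) → walkSum δ c = 0)
    {s t : {t // t ∈ R.tri}} {p q : R.dual.Walk s t} (h : R.Homotopic p q) :
    walkSum δ p = walkSum δ q := by
  induction h with
  | refl => rfl
  | symm _ ih => exact ih.symm
  | trans _ _ ih₁ ih₂ => exact ih₁.trans ih₂
  | star p q c w hc => simp [walkSum_append, hδ _ c w hc]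

/-- In a simply connected region, increments that add up to zero around each grid vertex derive
from a potential. -/
theorem SimplyConnected.exists_potential (hR : R.SimplyConnected)
    (δ : {t // t ∈ R.tri} → {t // t ∈ R.tri} → ℤ)
    (hδ : ∀ t (c : R.dual.Walk t t) (w : GridVertex),
      (∀ x ∈ c.support, ∃ j, x.1.corner j = w) → walkSum δ c = 0) :
    ∃ f : {t // t ∈ R.tri} → ℤ, ∀ s t, R.dual.Adj s t → f t = f s + δ s t := by
  have loop (t) (c : R.dual.Walk t t) : walkSum δ c = 0 :=
    walkSum_eq_of_homotopic δ hδ (hR.null_homotopic t c)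
  obtain ⟨t₀⟩ := hR.connected.nonempty
  choose p _ using fun t => (hR.connected.preconnected t₀ t).exists_isPath
  refine ⟨fun t => walkSum δ (p t), fun s t hst => ?_⟩
  obtain ⟨q⟩ := hR.connected.preconnected t t₀
  have h₁ := loop _ ((p s).append (.cons hst q))
  have h₂ := loop _ ((p t).append q)
  simp only [walkSum_append, walkSum] at h₁ h₂
  linarith

/-- In a simply connected region, local heights on the corners of the triangles that have the same
differences on the common corners of adjacent triangles come from a height on the vertices. -/
theorem SimplyConnected.exists_height (hR : R.SimplyConnected) (g : {t // t ∈ R.tri} → Fin 3 → ℤ)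
    (hg : ∀ s t, R.dual.Adj s t → ∀ j k j' k', s.1.corner j = t.1.corner k →
      s.1.corner j' = t.1.corner k' → g s j - g t k = g s j' - g t k') :
    ∃ h : R.Vertex → ℤ, ∀ t i j, h (R.vertex t i) - h (R.vertex t j) = g t i - g t j := by
  classical
  -- The offset between the local heights of two triangles, read at any common corner.
  let δ (s t : {t // t ∈ R.tri}) : ℤ :=
    if h : ∃ jk : Fin 3 × Fin 3, s.1.corner jk.1 = t.1.corner jk.2 then
      g s h.choose.1 - g t h.choose.2 else 0
  have δ_eq {s t} (hst : R.dual.Adj s t) {j k} (hjk : s.1.corner j = t.1.corner k) :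
      δ s t = g s j - g t k := by
    have h : ∃ jk : Fin 3 × Fin 3, s.1.corner jk.1 = t.1.corner jk.2 := ⟨(j, k), hjk⟩
    simp only [δ, dif_pos h]
    exact hg s t hst _ _ _ _ h.choose_spec hjk
  have sum_star (w : GridVertex) {s t} (c : R.dual.Walk s t) :
      (∀ x ∈ c.support, ∃ j, x.1.corner j = w) → ∀ j k, s.1.corner j = w → t.1.corner k = w →
      walkSum δ c = g s j - g t k := by
    induction c with
    | nil =>
      intro _ j k hj hk
      obtain rfl := Triangle.corner_injective _ (hj.trans hk.symm)
      simp [walkSum]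
    | cons hst p ih =>
      intro hc j k hj hk
      obtain ⟨l, hl⟩ := hc _ (List.mem_cons_of_mem _ p.start_mem_support)
      rw [walkSum, ih (fun x hx => hc x (List.mem_cons_of_mem _ hx)) l k hl hk,
        δ_eq hst (hj.trans hl.symm)]
      ring
  obtain ⟨f, hf⟩ := hR.exists_potential δ fun t c w hc => by
    obtain ⟨j, hj⟩ := hc t c.start_mem_support
    simp [sum_star w c hc j j hj hj]
  refine ⟨Quot.lift (fun a => f a.1 + g a.1 a.2) ?_, fun t i j => ?_⟩
  · rintro ⟨s, j⟩ ⟨t, k⟩ ⟨hst, hjk⟩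
    simp only [hf s t hst, δ_eq hst hjk]
    ring
  · simp only [vertex]
    ring

/-! ### The projected graph -/

theorem Joined.symm {e : Edge} {s t : Triangle} (h : R.Joined e s t) : R.Joined e t s :=
  ⟨h.2.1, h.1, h.2.2.1.symm, h.2.2.2.2.1, h.2.2.2.1, h.2.2.2.2.2⟩

theorem Joined.side_eq {e : Edge} {s t : Triangle} (h : R.Joined e s t) :
    s.side e.i = t.side e.i := h.2.2.2.1.trans h.2.2.2.2.1.symm

/-- The two triangles at an inner edge share the source of this edge. -/
theorem Joined.vertex_eq {e : Edge} {s t : {t // t ∈ R.tri}} (h : R.Joined e s t) :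
    R.vertex s e.i = R.vertex t e.i :=
  Quot.sound ⟨⟨e, h⟩, congrArg Edge.src h.side_eq⟩

/-- The two triangles at an inner edge share the target of this edge. -/
theorem Joined.vertex_next_eq {e : Edge} {s t : {t // t ∈ R.tri}} (h : R.Joined e s t) :
    R.vertex s (s.1.next e.i) = R.vertex t (t.1.next e.i) :=
  Quot.sound ⟨⟨e, h⟩, by
    have := congrArg Edge.src h.side_eq
    simp only [Triangle.corner_next]
    simpa [Triangle.side] using this⟩

theorem DirPath.trans {u v w : R.Vertex} {m n : ℕ} (h : R.DirPath u v m) (h' : R.DirPath v w n) :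
    R.DirPath u w (m + n) := by
  induction h with
  | nil => simpa using h'
  | cons t i _ ih => simpa [Nat.add_right_comm] using DirPath.cons t i (ih h')

/-- As one can turn around each triangle, the graph of the ascending edges of a connected region
is strongly connected. -/
theorem SimplyConnected.exists_dirPath (hR : R.SimplyConnected) (u v : R.Vertex) :
    ∃ n, R.DirPath u v n := by
  have local_path (t) (i j : Fin 3) : ∃ n, R.DirPath (R.vertex t i) (R.vertex t j) n := by
    rcases t.1.eq_or_eq_next_or_eq_opp i j with rfl | rfl | rfl
    · exact ⟨_, .nil _⟩
    · exact ⟨_, .cons t _ (.nil _)⟩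
    · exact ⟨_, .cons t _ (.cons t _ (.nil _))⟩
  have walk_path {s t} (p : R.dual.Walk s t) (i j) :
      ∃ n, R.DirPath (R.vertex s i) (R.vertex t j) n := by
    induction p generalizing i with
    | nil => exact local_path _ i j
    | cons h _ ih =>
      obtain ⟨e, he⟩ := h
      obtain ⟨m, hm⟩ := local_path _ i e.i
      obtain ⟨n, hn⟩ := ih e.i
      exact ⟨m + n, hm.trans (he.vertex_eq ▸ hn)⟩
  obtain ⟨⟨s, i⟩, rfl⟩ := Quot.exists_rep u
  obtain ⟨⟨t, j⟩, rfl⟩ := Quot.exists_rep v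
  obtain ⟨p⟩ := hR.connected.preconnected s t
  exact walk_path p i j

theorem level_vertex_next (t : {t // t ∈ R.tri}) (i : Fin 3) :
    level (R.vertex t (t.1.next i)).place = level (R.vertex t i).place + 1 ∨
      level (R.vertex t (t.1.next i)).place = level (R.vertex t i).place - 2 := by
  change level (t.1.corner _) = level (t.1.corner _) + 1 ∨ level (t.1.corner _) = _
  rw [Triangle.corner_next]
  exact exists_level_add_dir _ _

theorem DirPath.level_emod {u v : R.Vertex} {n : ℕ} (h : R.DirPath u v n) :
    (level v.place - level u.place - n) % 3 = 0 := by
  induction h with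
  | nil => simp
  | cons t i _ ih =>
    have := level_vertex_next t i
    push_cast
    omega

namespace StackCube

theorem ext_height {a b : R.StackCube} (hs : a.stack = b.stack)
    (hh : a.cube.height = b.cube.height) : a = b :=
  StackCube.ext hs (Cube.ext_height (by rw [a.proj_cube, b.proj_cube, hs]) hh)

theorem height_emod (a : R.StackCube) : (a.cube.height - level a.stack.place) % 3 = 0 := by
  rw [Cube.height_eq, a.proj_cube]; omega

end StackCube

/-- Every integer of the right residue modulo `3` is the height of a cube in a given stack. -/
theorem exists_stackCube (v : R.Vertex) {m : ℤ} (hm : (m - level v.place) % 3 = 0) :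
    ∃ a : R.StackCube, a.stack = v ∧ a.cube.height = m := by
  obtain ⟨c, hc, hh⟩ := exists_cube v.place ((m - level v.place) / 3)
  exact ⟨⟨v, c, hc⟩, rfl, by simp only [hh]; omega⟩

theorem exists_stackCube_height_le (v : R.Vertex) (m : ℤ) :
    ∃ a : R.StackCube, a.stack = v ∧ a.cube.height ≤ m := by
  obtain ⟨a, ha, hh⟩ := exists_stackCube v (m := m - (m - level v.place) % 3) (by omega)
  exact ⟨a, ha, by omega⟩

theorem exists_stackCube_le_height (v : R.Vertex) (m : ℤ) :
    ∃ a : R.StackCube, a.stack = v ∧ m ≤ a.cube.height := by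
  obtain ⟨a, ha, hh⟩ := exists_stackCube v (m := m + (level v.place - m) % 3) (by omega)
  exact ⟨a, ha, by omega⟩

theorem up_iff (a b : R.StackCube) :
    R.Up a b ↔ (∃ t i, a.stack = R.vertex t i ∧ b.stack = R.vertex t (t.1.next i)) ∧
      b.cube.height = a.cube.height + 1 := by
  constructor
  · rintro ⟨t, i, ha, hb, h⟩
    exact ⟨⟨t, i, ha, hb⟩, by rw [h, Cube.height_add_single]⟩
  · rintro ⟨⟨t, i, ha, hb⟩, h⟩
    refine ⟨t, i, ha, hb, Cube.ext_height ?_ (by rw [h, Cube.height_add_single])⟩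
    rw [proj_add_single, a.proj_cube, b.proj_cube, ha, hb]
    exact t.1.corner_next i

/-- A directed path of vertices lifts to a path of cubes. -/
theorem DirPath.reflTransGen_up {u v : R.Vertex} {n : ℕ} (h : R.DirPath u v n)
    {a b : R.StackCube} (ha : a.stack = u) (hb : b.stack = v)
    (hh : b.cube.height = a.cube.height + n) : Relation.ReflTransGen R.Up a b := by
  induction h generalizing a with
  | nil =>
    obtain rfl : a = b := StackCube.ext_height (ha.trans hb.symm) (by simpa using hh.symm)
    exact .refl
  | cons t i _ ih =>
    have := level_vertex_next t i
    have hm := a.height_emod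
    rw [ha] at hm
    obtain ⟨c, hc, hch⟩ := exists_stackCube (R.vertex t (t.1.next i))
      (m := a.cube.height + 1) (by omega)
    refine .head ((up_iff a c).2 ⟨⟨t, i, ha, hc⟩, hch⟩) (ih hc hb ?_)
    push_cast at hh
    omega

/-- The arcs of the projected graph and their weights, without reference to cubes. -/
inductive Step (R : Region) (X : Set Edge) : R.Vertex → R.Vertex → ℤ → Prop
  | up (t i) : Step R X (R.vertex t i) (R.vertex t (t.1.next i)) 1
  | downBoundary (t i) (h : R.IsBoundarySide t i) :
      Step R X (R.vertex t (t.1.next i)) (R.vertex t i) (-1)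
  | downX (t i) (h : t.1.side i ∈ X) : Step R X (R.vertex t (t.1.next i)) (R.vertex t i) (-1)
  | flat (s t : {t // t ∈ R.tri}) (e) (he : e ∈ X) (h : R.Joined e s t) :
      Step R X (R.vertex s (s.1.opp e.i)) (R.vertex t (t.1.opp e.i)) 0

theorem Step.level_emod {u v : R.Vertex} {w : ℤ} (h : R.Step X u v w) :
    (level v.place - level u.place - w) % 3 = 0 := by
  cases h with
  | up t i => have := level_vertex_next t i; omega
  | downBoundary t i _ => have := level_vertex_next t i; omega
  | downX t i _ => have := level_vertex_next t i; omega
  | flat s t e _ h =>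
    change (level (t.1.corner _) - level (s.1.corner _) - 0) % 3 = 0
    have hs := exists_level_add_dir (s.1.corner (s.1.opp e.i)) (s.1.opp e.i)
    have ht := exists_level_add_dir (t.1.corner (t.1.opp e.i)) (t.1.opp e.i)
    have := congrArg Edge.src h.side_eq
    simp only [Triangle.side] at this
    rw [Triangle.corner_opp_add_dir] at hs ht
    rw [this] at hs
    dsimp only
    omega

theorem Flat.symm {a b : R.StackCube} (h : R.Flat X a b) : R.Flat X b a := by
  obtain ⟨s, t, e, he, hst, ha, hb, c, hc, hac, hbc⟩ := h
  exact ⟨t, s, e, he, hst.symm, hb, ha, c, hc, hbc, hac⟩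

theorem flat_iff (a b : R.StackCube) :
    R.Flat X a b ↔ (∃ s t : {t // t ∈ R.tri}, ∃ e ∈ X, R.Joined e s t ∧
      a.stack = R.vertex s (s.1.opp e.i) ∧ b.stack = R.vertex t (t.1.opp e.i)) ∧
      b.cube.height = a.cube.height := by
  constructor
  · rintro ⟨s, t, e, he, hst, ha, hb, c, hc, hac, hbc⟩
    exact ⟨⟨s, t, e, he, hst, ha, hb⟩, by rw [hac, hbc]; simp only [Cube.height_sub_single]⟩
  · rintro ⟨⟨s, t, e, he, hst, ha, hb⟩, hh⟩
    have hs : s.1.corner e.i = e.src := congrArg Edge.src hst.2.2.2.1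
    have ht : t.1.corner e.i = e.src := congrArg Edge.src hst.2.2.2.2.1
    have hc : proj (a.cube + Pi.single (s.1.opp e.i) 1) = e.src := by
      rw [proj_add_single, a.proj_cube, ha, ← hs]
      exact s.1.corner_opp_add_dir e.i
    refine ⟨s, t, e, he, hst, ha, hb, _, hc, by simp, Cube.ext_height ?_ ?_⟩
    · rw [proj_sub_single, hc, b.proj_cube, hb, eq_sub_iff_add_eq, ← ht]
      exact t.1.corner_opp_add_dir e.i
    · rw [Cube.height_sub_single, Cube.height_add_single, hh]
      ring

/-- Whether two cubes are joined by an arc depends only on their stacks and on the difference of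
their heights. -/
theorem arc_iff_step (a b : R.StackCube) :
    R.Arc X a b ↔ R.Step X a.stack b.stack (b.cube.height - a.cube.height) := by
  constructor
  · rintro (h | ⟨t, i, h, ha, hb, hab⟩ | ⟨t, i, h, ha, hb, hab⟩ | h)
    · obtain ⟨⟨t, i, ha, hb⟩, hh⟩ := (up_iff a b).1 h
      rw [ha, hb, hh, add_sub_cancel_left]
      exact .up t i
    · rw [ha, hb, hab, Cube.height_add_single, sub_add_cancel_left]
      exact .downBoundary t i h
    · rw [ha, hb, hab, Cube.height_add_single, sub_add_cancel_left]
      exact .downX t i h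
    · obtain ⟨⟨s, t, e, he, hst, ha, hb⟩, hh⟩ := (flat_iff a b).1 h
      rw [ha, hb, hh, sub_self]
      exact .flat s t e he hst
  · generalize hu : a.stack = u
    generalize hv : b.stack = v
    generalize hw : b.cube.height - a.cube.height = w
    have hdown {t i} (ha : a.stack = R.vertex t (t.1.next i)) (hb : b.stack = R.vertex t i)
        (hab : b.cube.height - a.cube.height = -1) : a.cube = b.cube + Pi.single i 1 := by
      obtain ⟨t', i', h₁, h₂, h₃⟩ := (up_iff b a).2 ⟨⟨t, i, hb, ha⟩, by omega⟩
      refine Cube.ext_height ?_ (by rw [Cube.height_add_single]; omega)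
      rw [proj_add_single, a.proj_cube, b.proj_cube, ha, hb]
      exact t.1.corner_next i
    rintro (⟨t, i⟩ | ⟨t, i, h⟩ | ⟨t, i, h⟩ | ⟨s, t, e, he, h⟩)
    · exact .inl ((up_iff a b).2 ⟨⟨t, i, hu, hv⟩, by omega⟩)
    · exact .inr (.inl ⟨t, i, h, hu, hv, hdown hu hv hw⟩)
    · exact .inr (.inr (.inl ⟨t, i, h, hu, hv, hdown hu hv hw⟩))
    · exact .inr (.inr (.inr ((flat_iff a b).2 ⟨⟨s, t, e, he, h, hu, hv⟩, by omega⟩)))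

theorem projArc_iff_step (u v : R.Vertex) (w : ℤ) : R.ProjArc X u v w ↔ R.Step X u v w := by
  constructor
  · rintro ⟨a, b, h, rfl, rfl, rfl⟩
    exact (arc_iff_step a b).1 h
  · intro h
    obtain ⟨a, ha, -⟩ := exists_stackCube_height_le u 0
    have hm := a.height_emod
    have := h.level_emod
    rw [ha] at hm
    obtain ⟨b, hb, hh⟩ := exists_stackCube v (m := a.cube.height + w) (by omega)
    refine ⟨a, b, (arc_iff_step a b).2 ?_, ha, hb, by omega⟩
    rwa [ha, hb, hh, add_sub_cancel_left]

/-- The unbreakable edges can be followed in both ways. -/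
theorem Unbreakable.arc_symm {a b : R.StackCube} (h : R.Unbreakable X a b) : R.Arc X b a := by
  rcases h with ⟨t, i, -, ha, hb, hab⟩ | ⟨t, i, -, ha, hb, hab⟩ | h
  · exact .inl ⟨t, i, hb, ha, hab⟩
  · exact .inl ⟨t, i, hb, ha, hab⟩
  · exact .inr (.inr (.inr h.symm))

theorem ProjPath.trans {u v x : R.Vertex} {w m : ℤ} (h : R.ProjPath X u v w)
    (h' : R.ProjPath X v x m) : R.ProjPath X u x (w + m) := by
  induction h with
  | nil => simpa using h'
  | cons hstep _ ih => simpa [add_assoc] using ProjPath.cons hstep (ih h')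

theorem DirPath.projPath {u v : R.Vertex} {n : ℕ} (h : R.DirPath u v n) :
    R.ProjPath X u v n := by
  induction h with
  | nil => exact .nil _
  | cons t i _ ih =>
    simpa [add_comm] using ProjPath.cons ((projArc_iff_step _ _ _).2 (.up t i)) ih

/-- A path of the projected graph lifts to a path of cubes. -/
theorem ProjPath.exists_lift {u v : R.Vertex} {w : ℤ} (h : R.ProjPath X u v w)
    {a : R.StackCube} (ha : a.stack = u) :
    ∃ b : R.StackCube, b.stack = v ∧ b.cube.height = a.cube.height + w ∧
      Relation.ReflTransGen (R.Arc X) a b := by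
  induction h generalizing a with
  | nil => exact ⟨a, ha, by simp, .refl⟩
  | @cons u v x w m hstep _ ih =>
    rw [projArc_iff_step] at hstep
    have hm := a.height_emod
    have := hstep.level_emod
    rw [ha] at hm
    obtain ⟨c, hc, hh⟩ := exists_stackCube v (m := a.cube.height + w) (by omega)
    obtain ⟨b, hb, hbh, hcb⟩ := ih hc
    refine ⟨b, hb, by omega, .head ((arc_iff_step a c).2 ?_) hcb⟩
    rwa [ha, hc, hh, add_sub_cancel_left]

/-! ### Potentials -/

/-- A potential of the weighted projected graph: a height on the vertices of the region that
increases by at most the weight of each arc. -/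
def IsPotential (R : Region) (X : Set Edge) (h : R.Vertex → ℤ) : Prop :=
  ∀ u v w, R.ProjArc X u v w → h v ≤ h u + w

namespace IsPotential

variable {h : R.Vertex → ℤ}

theorem le_of_step (hh : R.IsPotential X h) {u v : R.Vertex} {w : ℤ} (hs : R.Step X u v w) :
    h v ≤ h u + w :=
  hh u v w ((projArc_iff_step u v w).2 hs)

theorem le_add_dirPath (hh : R.IsPotential X h) {u v : R.Vertex} {n : ℕ} (hp : R.DirPath u v n) :
    h v ≤ h u + n := by
  induction hp with
  | nil => simp
  | cons t i _ ih =>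
    have := hh.le_of_step (.up t i)
    push_cast
    omega

/-- Rounding a potential down makes it take the heights of the cubes of each stack, since the
weights are congruent modulo `3` to the differences of level. -/
theorem exists_emod_eq_zero (hh : R.IsPotential X h) :
    ∃ h' : R.Vertex → ℤ, R.IsPotential X h' ∧ ∀ v, (h' v - level v.place) % 3 = 0 := by
  refine ⟨fun v => h v - (h v - level v.place) % 3, fun u v w huv => ?_,
    fun v => by dsimp only; omega⟩
  have := ((projArc_iff_step u v w).1 huv).level_emod
  have := hh u v w huv
  dsimp only
  omega

theorem next_of_mem (hh : R.IsPotential X h) {t : {t // t ∈ R.tri}} {i : Fin 3}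
    (hX : t.1.side i ∈ X) : h (R.vertex t (t.1.next i)) = h (R.vertex t i) + 1 := by
  have := hh.le_of_step (.up t i)
  have := hh.le_of_step (.downX t i hX)
  omega

theorem next_of_isBoundarySide (hh : R.IsPotential X h) {t : {t // t ∈ R.tri}} {i : Fin 3}
    (hb : R.IsBoundarySide t i) : h (R.vertex t (t.1.next i)) = h (R.vertex t i) + 1 := by
  have := hh.le_of_step (.up t i)
  have := hh.le_of_step (.downBoundary t i hb)
  omega

theorem opp_eq_opp (hh : R.IsPotential X h) {s t : {t // t ∈ R.tri}} {e : Edge} (he : e ∈ X)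
    (hst : R.Joined e s t) : h (R.vertex s (s.1.opp e.i)) = h (R.vertex t (t.1.opp e.i)) := by
  have := hh.le_of_step (.flat s t e he hst)
  have := hh.le_of_step (.flat t s e he hst.symm)
  omega

end IsPotential

/-- The infimum of sets of heights that can be followed along the arcs of the projected graph is a
potential. -/
theorem isPotential_sInf {S : R.Vertex → Set ℤ} (hne : ∀ v, (S v).Nonempty)
    (hbdd : ∀ v, BddBelow (S v))
    (hS : ∀ u v w, R.Step X u v w → ∀ m ∈ S u, ∃ m' ∈ S v, m' ≤ m + w) :
    R.IsPotential X fun v => sInf (S v) := by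
  intro u v w huv
  obtain ⟨m', hm', hle⟩ := hS u v w ((projArc_iff_step u v w).1 huv) _
    (Int.csInf_mem (hne u) (hbdd u))
  exact (csInf_le (hbdd v) hm').trans hle

/-- Without absorbing cycle, the least weight of a path from a fixed vertex is a potential: it is
finite, because there is a path back to that vertex. -/
theorem exists_isPotential_of_not_hasAbsorbingCycle (hR : R.SimplyConnected)
    (hX : ¬ R.HasAbsorbingCycle X) : ∃ h, R.IsPotential X h := by
  obtain ⟨t₀⟩ := hR.connected.nonempty
  let u₀ := R.vertex t₀ 0
  refine ⟨_, isPotential_sInf (S := fun v => {w | R.ProjPath X u₀ v w}) (fun v => ?_) (fun v => ?_)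
    fun u v w huv m hm => ⟨m + w, ?_, le_rfl⟩⟩
  · obtain ⟨n, hn⟩ := hR.exists_dirPath u₀ v
    exact ⟨n, hn.projPath⟩
  · obtain ⟨n, hn⟩ := hR.exists_dirPath v u₀
    refine ⟨-n, fun w hw => ?_⟩
    by_contra! hlt
    exact hX ⟨u₀, _, ProjPath.trans hw hn.projPath, by omega⟩
  · have := ProjPath.trans hm (.cons ((projArc_iff_step u v w).2 huv) (.nil v))
    simpa using this

theorem IsPotential.exists_dagCut (hR : R.SimplyConnected) {h : R.Vertex → ℤ}
    (hh : R.IsPotential X h) :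
    ∃ L : Set R.StackCube, R.IsDAGCut L ∧ ∀ a b, R.Unbreakable X a b → ¬ R.Cuts L a b := by
  obtain ⟨t₀⟩ := hR.connected.nonempty
  have harc {a b : R.StackCube} (hab : R.Arc X a b) (hb : b.cube.height ≤ h b.stack) :
      a.cube.height ≤ h a.stack := by
    have := hh.le_of_step ((arc_iff_step a b).1 hab)
    omega
  refine ⟨{a | a.cube.height ≤ h a.stack}, ⟨?_, ?_, fun a ha b hba => ?_⟩, fun a b hab => ?_⟩
  · obtain ⟨a, hs, ha⟩ := exists_stackCube_height_le (R.vertex t₀ 0) (h (R.vertex t₀ 0))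
    exact ⟨a, by rwa [← hs] at ha⟩
  · obtain ⟨a, hs, ha⟩ := exists_stackCube_le_height (R.vertex t₀ 0) (h (R.vertex t₀ 0) + 1)
    rw [← hs] at ha
    exact ⟨a, fun h' => (Int.lt_of_add_one_le ha).not_ge h'⟩
  · induction hba using Relation.ReflTransGen.head_induction_on with
    | refl => exact ha
    | head hab _ ih => exact harc (.inl hab) ih
  · rintro (⟨ha, hb⟩ | ⟨ha, hb⟩)
    · exact hb (harc hab.arc_symm ha)
    · exact ha (harc (.inr hab) hb)

/-- In a simply connected region a cube can be reached from every cube of another stack (or of the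
same one) that is low enough. -/
theorem SimplyConnected.exists_reflTransGen_up (hR : R.SimplyConnected) (u v : R.Vertex) :
    ∃ n : ℤ, ∀ a b : R.StackCube, a.stack = u → b.stack = v →
      a.cube.height + n ≤ b.cube.height → Relation.ReflTransGen R.Up a b := by
  obtain ⟨n, hn⟩ := hR.exists_dirPath u v
  obtain ⟨⟨t, j⟩, rfl⟩ := Quot.exists_rep v
  -- Turning `k` times around a triangle climbs `3 * k` levels in a stack.
  have hloop (k : ℕ) : R.DirPath (R.vertex t j) (R.vertex t j) (3 * k) := by
    induction k with
    | zero => exact .nil _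
    | succ k ih =>
      have h₃ : R.DirPath (R.vertex t (t.1.next (t.1.opp j))) (R.vertex t j) 0 :=
        (t.1.next_opp j).symm ▸ DirPath.nil (R.vertex t j)
      exact ih.trans (.cons t j (.cons t _ (.cons t _ h₃)))
  refine ⟨n, fun a b ha hb hab => ?_⟩
  have h₁ := a.height_emod
  have h₂ := b.height_emod
  have h₃ := hn.level_emod
  rw [ha] at h₁
  rw [hb] at h₂
  refine (hn.trans (hloop ((b.cube.height - a.cube.height - n) / 3).toNat)).reflTransGen_up
    ha hb ?_
  push_cast
  omega

theorem IsDAGCut.not_hasDescendingPath (hR : R.SimplyConnected) {L : Set R.StackCube}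
    (hL : R.IsDAGCut L) (hX : ∀ a b, R.Unbreakable X a b → ¬ R.Cuts L a b) :
    ¬ R.HasDescendingPath X := by
  have harc {a b : R.StackCube} (hab : Relation.ReflTransGen (R.Arc X) a b) (hb : b ∈ L) :
      a ∈ L := by
    induction hab using Relation.ReflTransGen.head_induction_on with
    | refl => exact hb
    | @head a c hac _ ih =>
      rcases hac with hac | hac
      · exact hL.lower c ih a (.single hac)
      · by_contra ha
        exact hX a c hac (.inr ⟨ha, ih⟩)
  rintro ⟨p, q, k, hk, hpq, hs, hc⟩
  have hq : q.cube.height = p.cube.height - 3 * k := by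
    simp only [Cube.height, hc]; ring
  -- The descending path can be translated, and repeated.
  have hdesc {a b : R.StackCube} (hab : Relation.ReflTransGen (R.Arc X) a b) :
      ∀ a' b' : R.StackCube, a'.stack = a.stack → b'.stack = b.stack →
        b'.cube.height - a'.cube.height = b.cube.height - a.cube.height →
        Relation.ReflTransGen (R.Arc X) a' b' := by
    induction hab using Relation.ReflTransGen.head_induction_on with
    | refl =>
      intro a' b' ha hb hh
      obtain rfl : a' = b' := StackCube.ext_height (ha.trans hb.symm) (by omega)
      exact .refl
    | @head a c hac _ ih =>
      intro a' b' ha hb hh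
      have h₁ := a.height_emod
      have h₂ := a'.height_emod
      have h₃ := c.height_emod
      rw [ha] at h₂
      obtain ⟨c', hc', hch⟩ := exists_stackCube c.stack
        (m := c.cube.height + (a'.cube.height - a.cube.height)) (by omega)
      refine .head ((arc_iff_step a' c').2 ?_) (ih c' b' hc' hb (by omega))
      rw [ha, hc', hch, show c.cube.height + (a'.cube.height - a.cube.height) - a'.cube.height =
        c.cube.height - a.cube.height by ring]
      exact (arc_iff_step a c).1 hac
  have hrepeat (n : ℕ) : ∀ a b : R.StackCube, a.stack = p.stack → b.stack = p.stack →
      b.cube.height = a.cube.height - n * (3 * k) → Relation.ReflTransGen (R.Arc X) a b := by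
    induction n with
    | zero =>
      intro a b ha hb hh
      obtain rfl : a = b := StackCube.ext_height (ha.trans hb.symm) (by simp [hh])
      exact .refl
    | succ n ih =>
      intro a b ha hb hh
      have h₁ := b.height_emod
      obtain ⟨c, hc, hch⟩ := exists_stackCube b.stack (m := b.cube.height + 3 * k) (by omega)
      refine (ih a c ha (hc.trans hb) ?_).trans
        (hdesc hpq c b (hc.trans hb) (hb.trans hs.symm) (by omega))
      rw [hch, hh]
      push_cast
      ring
  -- Hence a path from each cube to each other one: climb to the stack, descend, climb again.
  obtain ⟨a, ha⟩ := hL.nonempty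
  obtain ⟨b, hb⟩ := hL.nonempty_compl
  obtain ⟨m, hm⟩ := hR.exists_reflTransGen_up b.stack p.stack
  obtain ⟨n, hn⟩ := hR.exists_reflTransGen_up p.stack a.stack
  obtain ⟨c, hc, hch⟩ := exists_stackCube_le_height p.stack (b.cube.height + m)
  obtain ⟨N, hN⟩ : ∃ N : ℕ, c.cube.height + n - a.cube.height ≤ N * (3 * k) :=
    ⟨(c.cube.height + n - a.cube.height).toNat, by
      nlinarith [Int.self_le_toNat (c.cube.height + n - a.cube.height)]⟩
  have h₁ := c.height_emod
  rw [hc] at h₁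
  obtain ⟨d, hd, hdh⟩ := exists_stackCube p.stack (m := c.cube.height - N * (3 * k)) (by
    rw [show c.cube.height - N * (3 * k) - level p.stack.place =
      c.cube.height - level p.stack.place - 3 * (N * k) by ring]
    omega)
  have up_le : ∀ {x y}, Relation.ReflTransGen R.Up x y → Relation.ReflTransGen (R.Arc X) x y :=
    fun h => Relation.ReflTransGen.mono (fun _ _ => Or.inl) _ _ h
  exact hb (harc ((up_le (hm b c rfl hc hch)).trans ((hrepeat N c d hc hd hdh).trans
    (up_le (hn d a hd rfl (by omega))))) ha)

theorem not_hasAbsorbingCycle (hX : ¬ R.HasDescendingPath X) : ¬ R.HasAbsorbingCycle X := by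
  rintro ⟨u, w, hp, hw⟩
  obtain ⟨a, rfl, -⟩ := exists_stackCube_height_le u 0
  obtain ⟨b, hb, hh, hab⟩ := hp.exists_lift rfl
  have hproj : proj b.cube = proj a.cube := by rw [a.proj_cube, b.proj_cube, hb]
  simp only [proj, Prod.mk.injEq, Cube.height] at hproj hh
  refine hX ⟨a, b, a.cube 0 - b.cube 0, by omega, hab, hb, fun j => ?_⟩
  fin_cases j <;> simp <;> omega

/-! ### From a tiling to a potential -/

/-- The heights of the corners of a triangle of which the side in direction `dir k` is overlapped
by a calisson: along the sides, they are `0`, `1`, `2`, and then `0` again. -/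
def localHeight (t : Triangle) (k j : Fin 3) : ℤ :=
  if j = k then 2 else if j = t.next k then 0 else 1

theorem localHeight_next (t : Triangle) (k i : Fin 3) :
    localHeight t k (t.next i) = localHeight t k i + if i = k then -2 else 1 := by
  obtain ⟨p, b⟩ := t
  cases b <;> fin_cases k <;> fin_cases i <;> rfl

theorem joined_of_side_eq {s t : {t // t ∈ R.tri}} {i : Fin 3} (hst : s ≠ t)
    (h : s.1.side i = t.1.side i) (hs : t.1.side i ∉ R.slit) : R.Joined (t.1.side i) s t :=
  ⟨s.2, t.2, fun h' => hst (Subtype.ext h'), h, rfl, hs⟩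

theorem IsTiling.normal_eq_iff {T : Set Calisson} (hT : R.IsTiling T) {e : Edge}
    {s t : Triangle} (hst : R.Joined e s t) {c d : Calisson} (hc : c ∈ T) (hcs : c.Covers s)
    (hd : d ∈ T) (hdt : d.Covers t) : c.normal = e.i ↔ d.normal = e.i := by
  have key {s t : Triangle} (hst : R.Joined e s t) {c d : Calisson} (hc : c ∈ T)
      (hcs : c.Covers s) (hd : d ∈ T) (hdt : d.Covers t) (h : c.normal = e.i) :
      d.normal = e.i := by
    have hct : c.Covers t := by
      rw [Calisson.Covers, h] at hcs ⊢
      rw [← hst.side_eq, hcs]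
    rw [(hT.partition t hst.2.1).unique ⟨hd, hdt⟩ ⟨hc, hct⟩, h]
  exact ⟨key hst hc hcs hd hdt, key hst.symm hd hdt hc hcs⟩

/-- A tiling gives a height to each vertex: it increases by `1` along each edge, except along those
that are overlapped by a calisson, where it decreases by `2`. -/
theorem IsTiling.exists_height (hR : R.SimplyConnected) {T : Set Calisson} (hT : R.IsTiling T) :
    ∃ h : R.Vertex → ℤ, ∀ t, ∀ c ∈ T, c.Covers t.1 → ∀ i,
      h (R.vertex t (t.1.next i)) = h (R.vertex t i) + if i = c.normal then -2 else 1 := by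
  choose col hcol _ using fun t : {t // t ∈ R.tri} => hT.partition t.1 t.2
  have hg (s t) (hst : R.dual.Adj s t) (j k j' k') (hjk : s.1.corner j = t.1.corner k)
      (hjk' : s.1.corner j' = t.1.corner k') :
      localHeight s.1 (col s).normal j - localHeight t.1 (col t).normal k =
        localHeight s.1 (col s).normal j' - localHeight t.1 (col t).normal k' := by
    -- Both local heights increase by the same amount along the common side.
    obtain ⟨e, he⟩ := hst
    have hiff := hT.normal_eq_iff he (hcol s).1 (hcol s).2 (hcol t).1 (hcol t).2
    have hs := localHeight_next s.1 (col s).normal e.i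
    have ht := localHeight_next t.1 (col t).normal e.i
    simp only [eq_comm (a := e.i), hiff] at hs ht
    rcases Triangle.common_corner he.side_eq he.2.2.1 hjk with ⟨rfl, rfl⟩ | ⟨rfl, rfl⟩ <;>
      rcases Triangle.common_corner he.side_eq he.2.2.1 hjk' with ⟨rfl, rfl⟩ | ⟨rfl, rfl⟩ <;>
      linarith
  obtain ⟨h, hh⟩ := hR.exists_height (fun t => localHeight t.1 (col t).normal) hg
  refine ⟨h, fun t c hc hct i => ?_⟩
  obtain rfl := (hT.partition t.1 t.2).unique ⟨hc, hct⟩ (hcol t)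
  have h₁ := hh t (t.1.next i) i
  have h₂ := localHeight_next t.1 (col t).normal i
  linarith

theorem IsTiling.normal_ne_of_isBoundarySide {T : Set Calisson} (hT : R.IsTiling T)
    {t : {t // t ∈ R.tri}} {i : Fin 3} (hb : R.IsBoundarySide t i) {c : Calisson} (hc : c ∈ T)
    (hct : c.Covers t.1) : i ≠ c.normal := by
  rintro rfl
  obtain ⟨s, hst, hs⟩ := t.1.exists_side_eq c.normal
  obtain ⟨hslit, hin⟩ := hT.inside c hc
  have hsR : s ∈ R.tri := hin s (hs.trans hct)
  rw [← hct] at hslit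
  exact hb s (joined_of_side_eq (s := ⟨s, hsR⟩)
    (fun h => hst (congrArg Subtype.val h)) hs hslit).symm

/-- The height of the corner opposite to a side along which the height increases by `1` tells the
colour of the calisson that covers the triangle. -/
theorem height_opp {h : R.Vertex → ℤ} {t : {t // t ∈ R.tri}} {k : Fin 3}
    (hh : ∀ i, h (R.vertex t (t.1.next i)) = h (R.vertex t i) + if i = k then -2 else 1)
    {i : Fin 3} (hi : i ≠ k) :
    h (R.vertex t (t.1.opp i)) = h (R.vertex t i) + if t.1.next i = k then -1 else 2 := by
  have h₁ := hh (t.1.next i)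
  have h₂ := hh i
  rw [if_neg hi] at h₂
  change h (R.vertex t (t.1.opp i)) = _ at h₁
  rw [h₁, h₂]
  split_ifs <;> ring

/-- The heights of the two vertices opposite to a common side express the saliency condition. -/
theorem Joined.height_opp_eq_iff {h : R.Vertex → ℤ} {e : Edge} {s t : {t // t ∈ R.tri}}
    (hst : R.Joined e s t) {k l : Fin 3}
    (hs : ∀ i, h (R.vertex s (s.1.next i)) = h (R.vertex s i) + if i = k then -2 else 1)
    (ht : ∀ i, h (R.vertex t (t.1.next i)) = h (R.vertex t i) + if i = l then -2 else 1)
    (hk : e.i ≠ k) (hl : e.i ≠ l) :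
    h (R.vertex s (s.1.opp e.i)) = h (R.vertex t (t.1.opp e.i)) ↔ k ≠ l := by
  have hopp := Triangle.opp_eq_next hst.side_eq hst.2.2.1
  have hne := t.1.opp_ne_next e.i
  rw [height_opp hs hk, height_opp ht hl, hst.vertex_eq, ← hopp]
  rcases t.1.eq_or_eq_next_or_eq_opp e.i k with rfl | rfl | rfl
  · exact absurd rfl hk
  all_goals rcases t.1.eq_or_eq_next_or_eq_opp e.i l with rfl | rfl | rfl
  · exact absurd rfl hl
  · simp [hne]
  · simp [hne, hne.symm]
  · exact absurd rfl hl
  · simp [hne]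
  · simp [hne.symm]

theorem IsSolution.exists_isPotential (hR : R.SimplyConnected) {T : Set Calisson}
    (hT : R.IsSolution X T) : ∃ h, R.IsPotential X h := by
  obtain ⟨h, hh⟩ := hT.tiling.exists_height hR
  refine ⟨h, fun u v w huv => ?_⟩
  rw [projArc_iff_step] at huv
  rcases huv with ⟨t, i⟩ | ⟨t, i, hb⟩ | ⟨t, i, hX⟩ | ⟨s, t, e, he, hst⟩
  · obtain ⟨c, ⟨hc, hct⟩, -⟩ := hT.tiling.partition t.1 t.2
    rw [hh t c hc hct]
    split_ifs <;> omega
  · obtain ⟨c, ⟨hc, hct⟩, -⟩ := hT.tiling.partition t.1 t.2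
    rw [hh t c hc hct, if_neg (hT.tiling.normal_ne_of_isBoundarySide hb hc hct)]
    omega
  · obtain ⟨c, ⟨hc, hct⟩, -⟩ := hT.tiling.partition t.1 t.2
    rw [hh t c hc hct, if_neg (by rintro rfl; exact hT.non_overlap _ hX c hc hct.symm)]
    omega
  · obtain ⟨c, ⟨hc, hcs⟩, -⟩ := hT.tiling.partition s.1 s.2
    obtain ⟨d, ⟨hd, hdt⟩, -⟩ := hT.tiling.partition t.1 t.2
    have hcd : c.normal ≠ d.normal := hT.saliency e he s t hst c hc d hd hcs hdt
    have hce : e.i ≠ c.normal := by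
      intro hce
      refine hT.non_overlap e he c hc ?_
      rw [← hcs, ← hce]
      exact hst.2.2.2.1
    have hde : e.i ≠ d.normal := fun hde =>
      hce ((hT.tiling.normal_eq_iff hst hc hcs hd hdt).2 hde.symm).symm
    rw [(hst.height_opp_eq_iff (hh s c hc hcs) (hh t d hd hdt) hce hde).2 hcd, add_zero]

/-! ### From a potential to a tiling -/

/-- When a potential takes the heights of cubes, it increases by `1` along two sides of each
triangle, and decreases by `2` along the third one. -/
theorem IsPotential.exists_drop {h : R.Vertex → ℤ} (hh : R.IsPotential X h)
    (hmod : ∀ v, (h v - level v.place) % 3 = 0) (t : {t // t ∈ R.tri}) :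
    ∃ k, ∀ i, h (R.vertex t (t.1.next i)) = h (R.vertex t i) + if i = k then -2 else 1 := by
  have hle (i) := hh.le_of_step (.up t i)
  have hlevel (i) := level_vertex_next t i
  have h₀ := hle 0
  have h₁ := hle (t.1.next 0)
  have h₂ := hle (t.1.opp 0)
  have l₀ := hlevel 0
  have l₁ := hlevel (t.1.next 0)
  change h (R.vertex t (t.1.opp 0)) ≤ _ at h₁
  change level (R.vertex t (t.1.opp 0)).place = _ ∨ level (R.vertex t (t.1.opp 0)).place = _ at l₁
  rw [t.1.next_opp] at h₂
  have m₀ := hmod (R.vertex t 0)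
  have m₁ := hmod (R.vertex t (t.1.next 0))
  have m₂ := hmod (R.vertex t (t.1.opp 0))
  have n₁ := t.1.next_ne 0
  have n₂ := t.1.opp_ne 0
  have n₃ := t.1.opp_ne_next 0
  have key : ∀ k, (h (R.vertex t (t.1.next 0)) = h (R.vertex t 0) + if 0 = k then -2 else 1) →
      (h (R.vertex t (t.1.opp 0)) = h (R.vertex t (t.1.next 0)) +
        if t.1.next 0 = k then -2 else 1) →
      (h (R.vertex t 0) = h (R.vertex t (t.1.opp 0)) + if t.1.opp 0 = k then -2 else 1) →
      ∀ i, h (R.vertex t (t.1.next i)) = h (R.vertex t i) + if i = k then -2 else 1 := by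
    intro k k₀ k₁ k₂ i
    rcases t.1.eq_or_eq_next_or_eq_opp 0 i with rfl | rfl | rfl
    · exact k₀
    · exact k₁
    · rw [t.1.next_opp]
      exact k₂
  have hcases : h (R.vertex t (t.1.next 0)) = h (R.vertex t 0) - 2 ∨
      h (R.vertex t (t.1.opp 0)) = h (R.vertex t (t.1.next 0)) - 2 ∨
      h (R.vertex t 0) = h (R.vertex t (t.1.opp 0)) - 2 := by omega
  rcases hcases with hk | hk | hk
  · refine ⟨0, key _ ?_ ?_ ?_⟩ <;> simp only [n₁, n₂, if_true, if_false] <;> omega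
  · refine ⟨t.1.next 0, key _ ?_ ?_ ?_⟩ <;>
      simp only [n₁.symm, n₃, if_true, if_false] <;> omega
  · refine ⟨t.1.opp 0, key _ ?_ ?_ ?_⟩ <;>
      simp only [n₂.symm, n₃.symm, if_true, if_false] <;> omega

/-- The calissons whose short diagonals are the edges along which the height does not increase. -/
def dropTiling (R : Region) (h : R.Vertex → ℤ) : Set Calisson :=
  {c | ∃ t : {t // t ∈ R.tri}, c.Covers t.1 ∧
    h (R.vertex t (t.1.next c.normal)) ≤ h (R.vertex t c.normal)}

/-- The drop along an inner edge can be read in both triangles at this edge. -/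
theorem mem_dropTiling_iff {h : R.Vertex → ℤ} (hh : R.IsPotential X h) {c : Calisson}
    {t : {t // t ∈ R.tri}} (hct : c.Covers t.1) :
    c ∈ R.dropTiling h ↔
      h (R.vertex t (t.1.next c.normal)) ≤ h (R.vertex t c.normal) := by
  refine ⟨fun ⟨s, hcs, hs⟩ => ?_, fun ht => ⟨t, hct, ht⟩⟩
  by_cases hst : s = t
  · exact hst ▸ hs
  have hside : s.1.side c.normal = t.1.side c.normal := hcs.trans hct.symm
  by_cases hslit : t.1.side c.normal ∈ R.slit
  · have := hh.next_of_isBoundarySide (t := s) (i := c.normal)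
      fun u hu => hu.2.2.2.2.2 (hside ▸ hslit)
    omega
  · have hJ := joined_of_side_eq hst hside hslit
    have h₁ := hJ.vertex_eq
    have h₂ := hJ.vertex_next_eq
    simp only [Triangle.side] at h₁ h₂
    rwa [← h₁, ← h₂]

theorem IsPotential.isSolution_dropTiling {h : R.Vertex → ℤ} (hh : R.IsPotential X h)
    (hmod : ∀ v, (h v - level v.place) % 3 = 0) : R.IsSolution X (R.dropTiling h) := by
  choose k hk using hh.exists_drop hmod
  have mem_iff {c : Calisson} {t : {t // t ∈ R.tri}} (hct : c.Covers t.1) :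
      c ∈ R.dropTiling h ↔ c.normal = k t := by
    rw [mem_dropTiling_iff hh hct, hk]
    split_ifs with h' <;> simp [h']
  refine ⟨⟨?_, fun t ht => ?_⟩, fun e he c hc hce => ?_,
    fun e he s t hst c hc d hd hcs hdt hcd => ?_⟩
  · rintro c ⟨t, hct, ht⟩
    have hb : ¬ R.IsBoundarySide t c.normal := fun hb => by
      have := hh.next_of_isBoundarySide hb
      omega
    simp only [IsBoundarySide, not_forall, not_not] at hb
    obtain ⟨s, hs⟩ := hb
    refine ⟨hct ▸ hs.2.2.2.2.2, fun u hcu => ?_⟩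
    by_cases hut : u = t
    · exact hut ▸ t.2
    -- The orientations of `s` and `u` are both opposite to that of `t`.
    have hside : u.side c.normal = t.1.side c.normal := hcu.trans hct.symm
    have h₁ := Triangle.pos_ne_of_side_eq hside hut
    have h₂ := Triangle.pos_ne_of_side_eq hs.symm.side_eq hs.symm.2.2.1
    have h₃ : u.pos = s.pos := by
      revert h₁ h₂
      cases u.pos <;> cases t.1.pos <;> cases s.pos <;> simp
    rw [Triangle.eq_of_side_eq (hside.trans hs.side_eq) h₃]
    exact hs.2.1
  · refine ⟨t.calisson (k ⟨t, ht⟩), ⟨(mem_iff (t := ⟨t, ht⟩) (t.calisson_covers _)).2 rfl,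
      t.calisson_covers _⟩, fun c ⟨hc, hct⟩ => ?_⟩
    rw [(t.covers_iff c).1 hct, (mem_iff (t := ⟨t, ht⟩) hct).1 hc]
  · obtain ⟨t, hct, ht⟩ := hc
    have := hh.next_of_mem (t := t) (i := c.normal) (X := X) (by rwa [hct, hce])
    omega
  · have hc' := (mem_iff (t := ⟨s, hst.1⟩) hcs).1 hc
    have hd' := (mem_iff (t := ⟨t, hst.2.1⟩) hdt).1 hd
    have hks : e.i ≠ k ⟨s, hst.1⟩ := fun hks => by
      have := hh.next_of_mem (t := ⟨s, hst.1⟩) (i := e.i) (hst.2.2.2.1.symm ▸ he)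
      rw [hk, if_pos hks] at this
      omega
    have hkt : e.i ≠ k ⟨t, hst.2.1⟩ := fun hkt =>
      hks (hkt.trans (hd'.symm.trans (hcd.symm.trans hc')))
    refine (Joined.height_opp_eq_iff (s := ⟨s, hst.1⟩) (t := ⟨t, hst.2.1⟩) hst (hk _) (hk _)
      hks hkt).1 (hh.opp_eq_opp he hst) ?_
    rw [← hc', ← hd']
    exact hcd

/-! ### The criterion on the boundary -/

theorem dirDist_le {u v : R.Vertex} {n : ℕ} (h : R.DirPath u v n) : R.dirDist u v ≤ n :=
  Nat.sInf_le h

theorem SimplyConnected.dirPath_dirDist (hR : R.SimplyConnected) (u v : R.Vertex) :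
    R.DirPath u v (R.dirDist u v) :=
  Nat.sInf_mem (hR.exists_dirPath u v)

theorem IsPotential.thurstonCriterion (hR : R.SimplyConnected) {h : R.Vertex → ℤ}
    (hh : R.IsPotential X h) : R.ThurstonCriterion :=
  ⟨h, fun _ _ hb => hh.next_of_isBoundarySide hb, fun u v _ _ => by
    have := hh.le_add_dirPath (hR.dirPath_dirDist u v)
    omega⟩

/-- The heights of the boundary extend to the largest potential that they allow. Without boundary,
the region is tiled by calissons of the same colour, of which `level` gives the heights. -/
theorem ThurstonCriterion.exists_isPotential (hR : R.SimplyConnected) (hT : R.ThurstonCriterion) :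
    ∃ h, R.IsPotential ∅ h := by
  obtain ⟨h, hb, hd⟩ := hT
  by_cases hne : ∃ u, R.IsBoundaryVertex u
  · obtain ⟨u₀, hu₀⟩ := hne
    have hle {u v : R.Vertex} (hu : R.IsBoundaryVertex u) (hv : R.IsBoundaryVertex v) {n : ℕ}
        (hn : R.DirPath u v n) : h v ≤ h u + n := by
      have := hd u v hu hv
      have := dirDist_le hn
      omega
    refine ⟨_, isPotential_sInf
      (S := fun v => {m | ∃ u n, R.IsBoundaryVertex u ∧ R.DirPath u v n ∧ m = h u + (n : ℕ)})
      (fun v => ?_) (fun v => ?_) ?_⟩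
    · obtain ⟨n, hn⟩ := hR.exists_dirPath u₀ v
      exact ⟨_, u₀, n, hu₀, hn, rfl⟩
    · obtain ⟨n, hn⟩ := hR.exists_dirPath v u₀
      refine ⟨h u₀ - n, ?_⟩
      rintro _ ⟨u, m, hu, hm, rfl⟩
      have := hle hu hu₀ (hm.trans hn)
      push_cast at this
      omega
    · rintro u v w (⟨t, i⟩ | ⟨t, i, hti⟩ | ⟨t, i, hX⟩ | ⟨s, t, e, he, -⟩) _ ⟨u', n, hu', hn, rfl⟩
      · exact ⟨_, ⟨u', n + 1, hu', hn.trans (.cons t i (.nil _)), rfl⟩, by push_cast; omega⟩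
      · refine ⟨_, ⟨_, 0, ⟨t, i, hti, .inl rfl⟩, .nil _, rfl⟩, ?_⟩
        have := hle hu' ⟨t, i, hti, .inr rfl⟩ hn
        have := hb t i hti
        push_cast
        omega
      · exact hX.elim
      · exact he.elim
  · refine ⟨fun v => level v.place, fun u v w huv => ?_⟩
    rw [projArc_iff_step] at huv
    rcases huv with ⟨t, i⟩ | ⟨t, i, hti⟩ | ⟨t, i, hX⟩ | ⟨s, t, e, he, -⟩
    · have := level_vertex_next t i
      dsimp only
      omega
    · exact (hne ⟨_, t, i, hti, .inl rfl⟩).elim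
    · exact hX.elim
    · exact he.elim

/-- The puzzle has a solution if and only if the projected graph has a potential. -/
theorem SimplyConnected.exists_isSolution_iff (hR : R.SimplyConnected) :
    (∃ T, R.IsSolution X T) ↔ ∃ h, R.IsPotential X h := by
  refine ⟨fun ⟨T, hT⟩ => hT.exists_isPotential hR, fun ⟨h, hh⟩ => ?_⟩
  obtain ⟨h', hh', hmod⟩ := hh.exists_emod_eq_zero
  exact ⟨_, hh'.isSolution_dropTiling hmod⟩

theorem isSolution_empty_iff {T : Set Calisson} : R.IsSolution ∅ T ↔ R.IsTiling T :=
  ⟨fun h => h.tiling, fun h => ⟨h, fun _ he => he.elim, fun _ he => he.elim⟩⟩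

end Region

end Calissons

theorem theorem5 (R : Calissons.Region) (hR : R.SimplyConnected) (X : Set Calissons.Edge) :
    List.TFAE [
      ∃ T : Set Calissons.Calisson, R.IsSolution X T,
      ∃ L : Set R.StackCube, R.IsDAGCut L ∧ ∀ a b, R.Unbreakable X a b → ¬ R.Cuts L a b,
      ¬ R.HasDescendingPath X,
      ¬ R.HasAbsorbingCycle X] ∧
    ((∃ T : Set Calissons.Calisson, R.IsTiling T) ↔ R.ThurstonCriterion) := by
  constructor
  · tfae_have 1 → 2 := fun ⟨T, hT⟩ =>
      let ⟨_, hh⟩ := hT.exists_isPotential hR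
      hh.exists_dagCut hR
    tfae_have 2 → 3 := fun ⟨L, hL, hX⟩ => hL.not_hasDescendingPath hR hX
    tfae_have 3 → 4 := Calissons.Region.not_hasAbsorbingCycle
    tfae_have 4 → 1 := fun h => hR.exists_isSolution_iff.2
      (Calissons.Region.exists_isPotential_of_not_hasAbsorbingCycle hR h)
    tfae_finish
  · simp only [← Calissons.Region.isSolution_empty_iff]
    rw [hR.exists_isSolution_iff]
    exact ⟨fun ⟨_, hh⟩ => hh.thurstonCriterion hR, fun h => h.exists_isPotential hR⟩
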